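/- For integers $n\ge 1$ and $k\ge 0$ let $\left\langle {n\atop k}\right\rangle$ be the Eulerian number, that is, the number of permutations $a_1a_2\cdots a_n$ of $\{1,2,\ldots,n\}$ with exactly $k$ ascents (indices $1\le i\le n-1$ with $a_i<a_{i+1}$); it is $0$ for $k\ge n$, and it is set to be $0$ for $k<0$. For an integer $x$ and $l\in\mathbb{N}=\{0,1,2,\ldots\}$ let $\binom{x}{l}=x(x-1)\cdots(x-l+1)/l!$, with $\binom{x}{0}=1$. For a prime $p$ and an integer $b$ let $\mathrm{ord}_p(b)=\sup\{i\in\mathbb{N}: p^i\mid b\}$, so that $\mathrm{ord}_p(0)=\infty$. Theorem 1.1. Let $p$ be a prime, let $n>0$ and $r$ be integers, and let $\alpha$ be a positive integer. Then for every $l\in\mathbb{N}$, $$\mathrm{ord}_p\Bigg(\sum_{k\equiv r\ (\mathrm{mod}\ p^{\alpha})}\left\langle {n\atop k}\right\rangle\binom{(k-r)/p^{\alpha}}{l}\Bigg)\ \ge\ \mathrm{ord}_p\left(\left\lfloor\frac{n}{p^{\alpha-1}}\right\rfloor!\right)-\left\lceil\frac{p^{\alpha-1}+lp^{\alpha}}{p^{\alpha-1}(p-1)}\right\rceil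 .$$ Moreover, if $a$ is an integer with $a\equiv 1\pmod p$ and $n\ge p^{\alpha}$, then $$\sum_{k\equiv r\ (\mathrm{mod}\ p^{\alpha})}\left\langle {n\atop k}\right\rangle a^k\equiv 0\pmod{p^{\,\mathrm{ord}_p(\lfloor n/p^{\alpha-1}\rfloor!)-1}} .$$ -/

import Mathlib

/-- The number of ascents of a permutation `π = a₁ a₂ ⋯ aₙ`, that is, the number of positions `i`
that are not the last one and satisfy `aᵢ < aᵢ₊₁` (positions and values are numbered from `0`). -/
def numAscents {n : ℕ} (π : Equiv.Perm (Fin n)) : ℕ :=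
  (Finset.univ.filter fun i : Fin n =>
    ∃ h : (i : ℕ) + 1 < n, π i < π ⟨(i : ℕ) + 1, h⟩).card

/-- The Eulerian number `⟨n, k⟩`: the number of permutations of `n` letters with exactly `k`
ascents. For `n > 0` it vanishes unless `0 ≤ k ≤ n - 1`. -/
def eulerian (n k : ℕ) : ℕ :=
  (Finset.univ.filter fun π : Equiv.Perm (Fin n) => numAscents π = k).card

/-- The `p`-adic order `sup {i ∈ ℕ : p ^ i ∣ a}` of an integer `a`, as an element of `ℤ ∪ {∞}`;
it is `∞` at `a = 0`. -/
noncomputable def padicOrd (p : ℕ) (a : ℤ) : WithTop ℤ :=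
  WithTop.map (fun i : ℕ => (i : ℤ)) (emultiplicity (p : ℤ) a)

/-! Put q = p^(α-1), P = p^α and φ = q(p-1) = P - q. Frobenius' identity `sum_X_pow_numAscents`
expands the Eulerian polynomial as ∑ S(n,j) (X-1)^(n-j), where S(n,j) counts surjections. The sums
to be estimated are values of a linear functional, `residueSum`, at this polynomial after X ↦ aX.
Two p-adic estimates compensate each other. S(n,j) has order at least ord_p(⌊n/q⌋!) - ⌊(n-j)/φ⌋
(`pow_dvd_surjectionNumber`), while `residueSum` of (aX-1)^m has order at least ⌊(m-q-lP)/φ⌋, a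
Fleck-type congruence (`pow_dvd_residueSum`). With m = n-j, each term loses at most ⌈(q+lP)/φ⌉,
whatever j is. -/

open Polynomial

/-! ### Surjection numbers and their convolution recurrence -/

/-- The number of surjections from an `n`-element set onto a `j`-element set. -/
def surjectionNumber : ℕ → ℕ → ℕ
  | 0, 0 => 1
  | 0, _ + 1 => 0
  | _ + 1, 0 => 0
  | n + 1, j + 1 => (j + 1) * (surjectionNumber n j + surjectionNumber n (j + 1))

theorem surjectionNumber_succ_succ (n j : ℕ) : surjectionNumber (n + 1) (j + 1) =
    (j + 1) * (surjectionNumber n j + surjectionNumber n (j + 1)) := rfl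

theorem surjectionNumber_succ (n j : ℕ) : surjectionNumber (n + 1) j =
    j * (surjectionNumber n (j - 1) + surjectionNumber n j) := by
  cases j <;> simp [surjectionNumber]

theorem surjectionNumber_eq_zero_of_lt {n j : ℕ} (h : n < j) : surjectionNumber n j = 0 := by
  induction n generalizing j with
  | zero => cases j <;> simp_all [surjectionNumber]
  | succ n ih =>
    cases j with
    | zero => omega
    | succ j => rw [surjectionNumber_succ_succ, ih (by omega), ih (by omega)]; simp

/-- Map a b-subset onto j values and send its complement to one further value, which is either
missed or hit. -/
theorem sum_choose_mul_surjectionNumber (n j : ℕ) :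
    ∑ b ∈ Finset.range (n + 1), n.choose b * surjectionNumber b j =
      surjectionNumber n j + surjectionNumber n (j + 1) := by
  induction n generalizing j with
  | zero => cases j <;> simp [surjectionNumber]
  | succ n ih =>
    have h1 : ∑ b ∈ Finset.range (n + 2), (n + 1).choose b * surjectionNumber b j =
        ∑ b ∈ Finset.range (n + 1), n.choose b * surjectionNumber b j +
        ∑ b ∈ Finset.range (n + 1), n.choose b * surjectionNumber (b + 1) j := by
      rw [Finset.sum_range_succ']
      simp only [Nat.choose_succ_succ', add_mul, Finset.sum_add_distrib, Nat.choose_zero_right,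
        one_mul]
      have h2 := Finset.sum_range_succ' (fun b => n.choose b * surjectionNumber b j) (n + 1)
      rw [Finset.sum_range_succ] at h2
      simp at h2
      omega
    have h3 : ∑ b ∈ Finset.range (n + 1), n.choose b * surjectionNumber (b + 1) j =
        j * (∑ b ∈ Finset.range (n + 1), n.choose b * surjectionNumber b (j - 1) +
          ∑ b ∈ Finset.range (n + 1), n.choose b * surjectionNumber b j) := by
      rw [← Finset.sum_add_distrib, Finset.mul_sum]
      refine Finset.sum_congr rfl fun b _ => ?_
      rw [surjectionNumber_succ]; ring
    rw [h1, h3, ih, ih, surjectionNumber_succ_succ]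
    cases j with
    | zero => simp [surjectionNumber]
    | succ j => rw [surjectionNumber_succ_succ]; simp; ring

theorem surjectionNumber_succ_right (n j : ℕ) : surjectionNumber n (j + 1) =
    ∑ b ∈ Finset.range n, n.choose b * surjectionNumber b j := by
  have h := sum_choose_mul_surjectionNumber n j
  rw [Finset.sum_range_succ] at h
  simp at h
  omega

/-! ### Divisibility of surjection numbers by powers of p -/

section Valuation

variable {p : ℕ} [Fact p.Prime]

/-- By Legendre, ord_p(n!) = ∑_{1≤i≤s} ⌊n/p^i⌋ + ord_p(⌊n/q⌋!). The first sum is superadditive in n,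
so the defect of the second part is at most the order of the binomial coefficient. -/
theorem padicValNat_factorial_div_add_le (q a b : ℕ) (s : ℕ) (hq : q = p ^ s) :
    padicValNat p ((a + b) / q).factorial ≤
      padicValNat p ((a + b).choose a) + padicValNat p (a / q).factorial +
        padicValNat p (b / q).factorial := by
  have hp : p.Prime := Fact.out
  have key (n B : ℕ) (hB : Nat.log p n < B) : padicValNat p n.factorial =
      ∑ i ∈ Finset.Ico 1 (s + 1), n / p ^ i + padicValNat p (n / q).factorial := by
    rw [padicValNat_factorial (b := s + B) (by omega),
      padicValNat_factorial (b := B) (lt_of_le_of_lt (Nat.log_mono_right (Nat.div_le_self _ _)) hB)]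
    rw [← Finset.sum_Ico_consecutive _ (by omega : 1 ≤ s + 1) (by omega : s + 1 ≤ s + B)]
    congr 1
    rw [Finset.sum_Ico_eq_sum_range, Finset.sum_Ico_eq_sum_range]
    refine Finset.sum_congr (by congr 1; omega) fun i _ => ?_
    rw [hq, Nat.div_div_eq_div_mul, ← pow_add]
    congr 2; omega
  have hab := key (a + b) (Nat.log p (a + b) + 1) (by omega)
  have ha := key a (Nat.log p a + 1) (by omega)
  have hb := key b (Nat.log p b + 1) (by omega)
  have hsum : ∑ i ∈ Finset.Ico 1 (s + 1), a / p ^ i + ∑ i ∈ Finset.Ico 1 (s + 1), b / p ^ i ≤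
      ∑ i ∈ Finset.Ico 1 (s + 1), (a + b) / p ^ i := by
    rw [← Finset.sum_add_distrib]
    exact Finset.sum_le_sum fun i _ => Nat.div_add_div_le_add_div
  rw [Nat.choose_symm_add]
  have hmul := congrArg (padicValNat p) (Nat.add_choose_mul_factorial_mul_factorial a b)
  rw [padicValNat.mul (mul_ne_zero (Nat.choose_pos (by omega)).ne' a.factorial_ne_zero)
    b.factorial_ne_zero, padicValNat.mul (Nat.choose_pos (by omega)).ne' a.factorial_ne_zero] at hmul
  omega

theorem padicValNat_factorial_div_le (q b : ℕ) (hq : 0 < q) :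
    padicValNat p (b / q).factorial ≤ (b - 1) / (q * (p - 1)) := by
  have hp : p.Prime := Fact.out
  have hp1 : 0 < p - 1 := by have := hp.two_le; omega
  rw [Nat.le_div_iff_mul_le (by positivity)]
  rcases Nat.eq_zero_or_pos (b / q) with h0 | h0
  · simp [h0]
  · have h1 : (p - 1) * padicValNat p (b / q).factorial ≤ b / q - 1 := by
      have := sub_one_mul_padicValNat_factorial_lt_of_ne_zero p h0.ne'
      omega
    have h2 : q * (b / q) ≤ b := Nat.mul_div_le b q
    calc _ = q * ((p - 1) * padicValNat p (b / q).factorial) := by ring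
      _ ≤ q * (b / q - 1) := by gcongr
      _ = q * (b / q) - q := by rw [Nat.mul_sub, mul_one]
      _ ≤ b - 1 := by omega

/-- Split off the fibre over one value: a fibre of size c ≥ 1 costs ⌊(c-1)/φ⌋, and these costs add
up because (b-j) + (c-1) = (b+c) - (j+1). -/
theorem pow_dvd_surjectionNumber (s n j : ℕ) :
    p ^ (padicValNat p (n / p ^ s).factorial - (n - j) / (p ^ s * (p - 1))) ∣
      surjectionNumber n j := by
  have hp : p.Prime := Fact.out
  have hp1 : 0 < p - 1 := by have := hp.two_le; omega
  have hq : 0 < p ^ s := pow_pos hp.pos s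
  induction j generalizing n with
  | zero =>
    cases n <;> simp [surjectionNumber]
  | succ j ih =>
    rw [surjectionNumber_succ_right]
    refine Finset.dvd_sum fun b hb => ?_
    rw [Finset.mem_range] at hb
    rcases lt_or_ge b j with hbj | hbj
    · simp [surjectionNumber_eq_zero_of_lt hbj]
    obtain ⟨c, rfl⟩ := Nat.exists_eq_add_of_le hb.le
    refine dvd_trans ?_ (mul_dvd_mul (pow_padicValNat_dvd (p := p)) (ih b))
    rw [← pow_add]
    refine pow_dvd_pow p ?_
    have h1 := padicValNat_factorial_div_add_le (p := p) _ b c s rfl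
    have h2 := padicValNat_factorial_div_le (p := p) (p ^ s) c hq
    have h3 : (b - j) / (p ^ s * (p - 1)) + (c - 1) / (p ^ s * (p - 1)) ≤
        (b + c - (j + 1)) / (p ^ s * (p - 1)) := by
      refine (Nat.div_add_div_le_add_div).trans (Nat.div_le_div_right (by omega))
    omega

end Valuation

/-! ### A weight filtration on ℤ[X] and Fleck-type congruences -/

section FleckFiltration

variable {p : ℕ}

/-- Give X-1 weight 1, p weight φ and X^P-1 weight P. Since P = φ + q and 2φ ≥ P, no term on the
right weighs less than (X-1)^P. This is why the error is needed modulo p² and not only modulo p. -/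
theorem exists_X_sub_one_pow_prime_pow_eq (hp : p.Prime) (s : ℕ) : ∃ u v : ℤ[X],
    (X - 1 : ℤ[X]) ^ p ^ (s + 1) =
      (X ^ p ^ (s + 1) - 1) + (p : ℤ[X]) * (X - 1) ^ p ^ s * u + (p : ℤ[X]) ^ 2 * v := by
  obtain ⟨g, hg⟩ := exists_add_pow_prime_pow_eq hp (X - 1 : ℤ[X]) 1 s
  obtain ⟨r, hr⟩ := exists_add_pow_prime_eq hp (X ^ p ^ s - 1 : ℤ[X]) 1
  have hdvd : (p : ℤ[X]) ∣ (X - 1 : ℤ[X]) ^ p ^ s - (X ^ p ^ s - 1) :=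
    ⟨-((X - 1) * g), by
      simp only [sub_add_cancel, one_pow, mul_one] at hg
      rw [hg]; ring⟩
  obtain ⟨v, hv⟩ := dvd_sub_pow_of_dvd_sub hdvd 1
  obtain ⟨h, hh⟩ := hdvd
  refine ⟨-r, h * r + v, ?_⟩
  simp only [sub_add_cancel, one_pow, mul_one, pow_one] at hr hv
  rw [pow_succ, pow_mul, pow_mul]
  linear_combination hv - hr + p * r * hh

/-- The ideal spanned by the products `p ^ a * (X ^ P - 1) ^ l` with `M < φ * a + P * l + P`. -/
noncomputable def fleckIdeal (p φ P M : ℕ) : Ideal ℤ[X] :=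
  Ideal.span {f | ∃ a l : ℕ, M < φ * a + P * l + P ∧ f = (p : ℤ[X]) ^ a * (X ^ P - 1) ^ l}

/-- Rewriting (X-1)^P repeatedly never lowers the weight and ends with an exponent i < P; that
leftover is the slack P in `fleckIdeal`. -/
theorem pow_mul_mem_fleckIdeal (hp : p.Prime) (s M i a l : ℕ)
    (h : M ≤ i + p ^ s * (p - 1) * a + p ^ (s + 1) * l) :
    (X - 1 : ℤ[X]) ^ i * ((p : ℤ[X]) ^ a * (X ^ p ^ (s + 1) - 1) ^ l) ∈
      fleckIdeal p (p ^ s * (p - 1)) (p ^ (s + 1)) M := by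
  have hp2 := hp.two_le
  have hq : 0 < p ^ s := pow_pos hp.pos s
  have hP : p ^ (s + 1) = p ^ s * (p - 1) + p ^ s := by
    obtain ⟨k, rfl⟩ := Nat.exists_eq_add_of_le hp2
    rw [pow_succ, show 2 + k - 1 = 1 + k by omega]; ring
  have hφ : p ^ s ≤ p ^ s * (p - 1) := Nat.le_mul_of_pos_right _ (by omega)
  induction i using Nat.strong_induction_on generalizing a l with
  | _ i ih =>
    rcases lt_or_ge i (p ^ (s + 1)) with hi | hi
    · exact Ideal.mul_mem_left _ _ (Ideal.subset_span ⟨a, l, by omega, rfl⟩)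
    · obtain ⟨j, rfl⟩ := Nat.exists_eq_add_of_le' hi
      obtain ⟨u, v, huv⟩ := exists_X_sub_one_pow_prime_pow_eq hp s
      have h1 := ih j (by omega) a (l + 1) (by rw [mul_add]; omega)
      have h2 := ih (j + p ^ s) (by omega) (a + 1) l (by rw [mul_add]; omega)
      have h3 := ih j (by omega) (a + 2) l (by rw [mul_add]; omega)
      have key := add_mem (add_mem h1 (Ideal.mul_mem_left _ u h2)) (Ideal.mul_mem_left _ v h3)
      convert key using 1
      rw [pow_add, huv]; ring

theorem C_mul_X_sub_one_pow_mem_fleckIdeal (hp : p.Prime) (s m : ℕ) {a : ℤ}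
    (ha : a ≡ 1 [ZMOD p]) :
    (C a * X - 1 : ℤ[X]) ^ m ∈ fleckIdeal p (p ^ s * (p - 1)) (p ^ (s + 1)) m := by
  have hp2 := hp.two_le
  have hφ : 1 ≤ p ^ s * (p - 1) := Nat.mul_pos (pow_pos hp.pos s) (by omega)
  obtain ⟨b, hb⟩ := ha.symm.dvd
  have hab : (C a * X - 1 : ℤ[X]) = (X - 1) + (p : ℤ[X]) * (C b * X) := by
    rw [eq_add_of_sub_eq hb]; simp; ring
  -- Each factor p(bX) weighs at least φ ≥ 1, so every binomial term has weight at least m.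
  rw [hab, add_pow]
  refine sum_mem fun i hi => ?_
  rw [Finset.mem_range] at hi
  have h := pow_mul_mem_fleckIdeal hp s m i (m - i) 0 (by
    have := Nat.le_mul_of_pos_left (m - i) hφ
    omega)
  convert Ideal.mul_mem_left _ ((C b * X) ^ (m - i) * (m.choose i : ℤ[X])) h using 1
  rw [mul_pow]; ring

/-- The weight `(x - r) / P choose l` of an exponent `x` congruent to `r` modulo `P`, and `0` for
the other exponents. -/
noncomputable def residueWeight (P r : ℤ) (l : ℕ) (x : ℤ) : ℤ :=
  if x ≡ r [ZMOD P] then Ring.choose ((x - r) / P) l else 0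

theorem residueWeight_add_sub {P : ℤ} (hP : P ≠ 0) (r : ℤ) (l : ℕ) (x : ℤ) :
    residueWeight P r (l + 1) (x + P) - residueWeight P r (l + 1) x = residueWeight P r l x := by
  have h : x + P ≡ r [ZMOD P] ↔ x ≡ r [ZMOD P] := by simp [Int.ModEq]
  by_cases hx : x ≡ r [ZMOD P]
  · rw [residueWeight, if_pos (h.2 hx), residueWeight, if_pos hx, residueWeight, if_pos hx,
      show x + P - r = x - r + P by ring, Int.add_ediv_of_dvd_right dvd_rfl, Int.ediv_self hP,
      Ring.choose_succ_succ]
    ring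
  · simp [residueWeight, h, hx]

theorem residueWeight_zero_add {P : ℤ} (r x : ℤ) :
    residueWeight P r 0 (x + P) = residueWeight P r 0 x := by
  simp [residueWeight, Int.ModEq]

/-- The sum of the coefficients of a polynomial, weighted by `residueWeight`. -/
noncomputable def residueSum (P r : ℤ) (l : ℕ) : ℤ[X] →ₗ[ℤ] ℤ :=
  Polynomial.lsum fun k => residueWeight P r l k • LinearMap.id

theorem residueSum_monomial (P r : ℤ) (l k : ℕ) (c : ℤ) :
    residueSum P r l (monomial k c) = c * residueWeight P r l k := by
  simp [residueSum, Polynomial.lsum_apply, Polynomial.sum_monomial_index, mul_comm]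

/-- Pascal's rule: multiplication by X^P-1 acts as a difference operator of step P and lowers l by
one. -/
theorem residueSum_succ_mul {P : ℕ} (hP : 0 < P) (r : ℤ) (l : ℕ) (f : ℤ[X]) :
    residueSum P r (l + 1) ((X ^ P - 1) * f) = residueSum P r l f := by
  induction f using Polynomial.induction_on' with
  | add f g hf hg => rw [mul_add, map_add, map_add, hf, hg]
  | monomial k c =>
    rw [sub_mul, one_mul, X_pow_mul_monomial, map_sub, residueSum_monomial, residueSum_monomial,
      residueSum_monomial, ← mul_sub]
    push_cast
    rw [residueWeight_add_sub (by exact_mod_cast hP.ne')]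

theorem residueSum_zero_mul (P : ℕ) (r : ℤ) (f : ℤ[X]) :
    residueSum P r 0 ((X ^ P - 1) * f) = 0 := by
  induction f using Polynomial.induction_on' with
  | add f g hf hg => rw [mul_add, map_add, hf, hg, add_zero]
  | monomial k c =>
    rw [sub_mul, one_mul, X_pow_mul_monomial, map_sub, residueSum_monomial, residueSum_monomial]
    push_cast
    rw [residueWeight_zero_add, sub_self]

theorem residueSum_pow_mul {P : ℕ} (hP : 0 < P) (r : ℤ) (l i : ℕ) (f : ℤ[X]) :
    residueSum P r l ((X ^ P - 1) ^ i * f) = if i ≤ l then residueSum P r (l - i) f else 0 := by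
  induction i generalizing l with
  | zero => simp
  | succ i ih =>
    rw [pow_succ', mul_assoc]
    cases l with
    | zero => simp [residueSum_zero_mul]
    | succ l => rw [residueSum_succ_mul hP, ih]; simp

theorem pow_dvd_residueSum (hp : p.Prime) (s M : ℕ) (r : ℤ) (l : ℕ) {f : ℤ[X]}
    (hf : f ∈ fleckIdeal p (p ^ s * (p - 1)) (p ^ (s + 1)) M) :
    (p : ℤ) ^ ((M - (p ^ s + l * p ^ (s + 1))) / (p ^ s * (p - 1))) ∣
      residueSum (p ^ (s + 1) : ℕ) r l f := by
  have hp2 := hp.two_le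
  have hP : p ^ (s + 1) = p ^ s * (p - 1) + p ^ s := by
    obtain ⟨k, rfl⟩ := Nat.exists_eq_add_of_le hp2
    rw [pow_succ, show 2 + k - 1 = 1 + k by omega]; ring
  refine Submodule.closure_induction (by simp) (fun x y _ _ hx hy => ?_) (fun g x hx => ?_) hf
  · rw [map_add]; exact dvd_add hx hy
  · obtain ⟨a, i, hM, rfl⟩ := hx
    have e : g • ((p : ℤ[X]) ^ a * (X ^ p ^ (s + 1) - 1) ^ i) =
        ((p : ℤ) ^ a) • ((X ^ p ^ (s + 1) - 1) ^ i * g) := by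
      rw [smul_eq_mul, zsmul_eq_mul]; push_cast; ring
    rw [e, map_smul, residueSum_pow_mul (pow_pos hp.pos _), smul_eq_mul]
    split_ifs with hi
    · refine Dvd.dvd.mul_right (pow_dvd_pow _ ?_) _
      have h1 : p ^ (s + 1) * i ≤ l * p ^ (s + 1) := by rw [mul_comm]; gcongr
      -- At most l factors X^P-1 survive, so M < φa + Pl + P = φ(a+1) + q + Pl, which bounds the
      -- quotient by a.
      refine Nat.lt_succ_iff.1 (Nat.div_lt_of_lt_mul ?_)
      rw [Nat.mul_succ]
      have hφ : 0 < p ^ s * (p - 1) := Nat.mul_pos (pow_pos hp.pos s) (by omega)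
      omega
    · simp

end FleckFiltration

/-! ### The Eulerian recurrence by inserting the largest letter -/

section Insertion

/-- The number of ascents of the first `n + 1` letters of a word. -/
def wordAscents (n : ℕ) (w : ℕ → ℕ) : ℕ := ∑ j ∈ Finset.range n, if w j < w (j + 1) then 1 else 0

/-- The word obtained by inserting the letter `M` at position `i`. -/
def insertLetter (i M : ℕ) (w : ℕ → ℕ) (j : ℕ) : ℕ :=
  if j < i then w j else if j = i then M else w (j - 1)

theorem wordAscents_congr {n : ℕ} {w w' : ℕ → ℕ} (h : ∀ j ≤ n, w j = w' j) :
    wordAscents n w = wordAscents n w' := by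
  refine Finset.sum_congr rfl fun j hj => ?_
  rw [Finset.mem_range] at hj
  rw [h j (by omega), h (j + 1) (by omega)]

theorem wordAscents_insertLetter_zero {n M : ℕ} {w : ℕ → ℕ} (h : ∀ j ≤ n, w j < M) :
    wordAscents (n + 1) (insertLetter 0 M w) = wordAscents n w := by
  rw [wordAscents, Finset.sum_range_succ']
  simp [insertLetter, wordAscents, (h 0 (by omega)).le]

theorem wordAscents_insertLetter_last {n M : ℕ} {w : ℕ → ℕ} (h : ∀ j ≤ n, w j < M) :
    wordAscents (n + 1) (insertLetter (n + 1) M w) = wordAscents n w + 1 := by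
  rw [wordAscents, Finset.sum_range_succ]
  congr 1
  · refine wordAscents_congr fun j hj => ?_
    simp [insertLetter, show j < n + 1 by omega]
  · simp [insertLetter, h n le_rfl]

theorem wordAscents_insertLetter_succ {n M i : ℕ} {w : ℕ → ℕ} (h : ∀ j ≤ n, w j < M)
    (hi : i < n) :
    wordAscents (n + 1) (insertLetter (i + 1) M w) =
      wordAscents n w + if w i < w (i + 1) then 0 else 1 := by
  obtain ⟨t, rfl⟩ := Nat.exists_eq_add_of_lt hi
  have e1 : wordAscents (i + t + 1) w = wordAscents i w +
      (if w i < w (i + 1) then 1 else 0) + wordAscents t (fun j => w (i + 1 + j)) := by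
    rw [wordAscents, show i + t + 1 = (i + 1) + t by omega, Finset.sum_range_add,
      Finset.sum_range_succ]
    rfl
  have e2 : wordAscents (i + t + 1 + 1) (insertLetter (i + 1) M w) = wordAscents i w + 1 + 0 +
      wordAscents t (fun j => w (i + 1 + j)) := by
    rw [wordAscents, show i + t + 1 + 1 = (i + 1 + 1) + t by omega, Finset.sum_range_add,
      Finset.sum_range_succ, Finset.sum_range_succ]
    congr 1
    · congr 1
      · congr 1
        · refine wordAscents_congr fun j hj => ?_
          simp [insertLetter, show j < i + 1 by omega]
        · simp [insertLetter, h i (by omega)]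
      · simp [insertLetter, (h (i + 1) (by omega)).le]
    · refine Finset.sum_congr rfl fun j _ => ?_
      have e (j : ℕ) : insertLetter (i + 1) M w (i + 1 + 1 + j) = w (i + 1 + j) := by
        rw [insertLetter, if_neg (by omega), if_neg (by omega)]
        congr 1
        omega
      rw [e, add_assoc (i + 1 + 1), e]
  rw [e1, e2]
  split_ifs <;> omega

/-- The front slot and the slots inside ascents keep the count; the end slot and all other slots
raise it by one. -/
theorem sum_wordAscents_insertLetter {R : Type*} [Semiring R] (f : ℕ → R) {n M : ℕ} {w : ℕ → ℕ}
    (h : ∀ j ≤ n, w j < M) :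
    ∑ i ∈ Finset.range (n + 2), f (wordAscents (n + 1) (insertLetter i M w)) =
      (wordAscents n w + 1 : ℕ) * f (wordAscents n w) +
        (n + 1 - wordAscents n w : ℕ) * f (wordAscents n w + 1) := by
  rw [Finset.sum_range_succ', wordAscents_insertLetter_zero h, Finset.sum_range_succ,
    wordAscents_insertLetter_last h]
  have h1 : ∀ i ∈ Finset.range n, f (wordAscents (n + 1) (insertLetter (i + 1) M w)) =
      (if w i < w (i + 1) then f (wordAscents n w) else f (wordAscents n w + 1)) := by
    intro i hi
    rw [wordAscents_insertLetter_succ h (Finset.mem_range.1 hi)]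
    split_ifs <;> rfl
  have h2 : ((Finset.range n).filter fun i => w i < w (i + 1)).card = wordAscents n w := by
    rw [Finset.card_filter]; rfl
  have h3 : ((Finset.range n).filter fun i => ¬ w i < w (i + 1)).card + wordAscents n w = n := by
    rw [← h2, add_comm, Finset.card_filter_add_card_filter_not, Finset.card_range]
  rw [Finset.sum_congr rfl h1, Finset.sum_ite, Finset.sum_const, Finset.sum_const, h2,
    show n + 1 - wordAscents n w =
      ((Finset.range n).filter fun i => ¬ w i < w (i + 1)).card + 1 by omega]
  simp only [nsmul_eq_mul, Nat.cast_add, Nat.cast_one, add_mul, one_mul]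
  abel

/-- The one-line notation of a permutation, as a word. -/
def permWord {n : ℕ} (π : Equiv.Perm (Fin n)) (j : ℕ) : ℕ := if h : j < n then π ⟨j, h⟩ else 0

theorem numAscents_eq_wordAscents {n : ℕ} (π : Equiv.Perm (Fin (n + 1))) :
    numAscents π = wordAscents n (permWord π) := by
  rw [numAscents, Finset.card_filter, Fin.sum_univ_castSucc, wordAscents, Finset.sum_range]
  simp only [Fin.val_last, lt_self_iff_false, IsEmpty.exists_iff, if_false, add_zero]
  refine Finset.sum_congr rfl fun i _ => ?_
  have hi := i.2
  simp [permWord, show (i : ℕ) < n + 1 by omega]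
  rfl

/-- The permutation obtained by inserting a new largest letter at position `i`. -/
def insertMax {n : ℕ} (i : Fin (n + 1)) (π : Equiv.Perm (Fin n)) : Equiv.Perm (Fin (n + 1)) :=
  ((finSuccEquiv' i).trans (Equiv.optionCongr π)).trans (finSuccEquiv' (Fin.last n)).symm

theorem insertMax_self {n : ℕ} (i : Fin (n + 1)) (π : Equiv.Perm (Fin n)) :
    insertMax i π i = Fin.last n := by
  simp [insertMax]

theorem insertMax_succAbove {n : ℕ} (i : Fin (n + 1)) (π : Equiv.Perm (Fin n)) (j : Fin n) :
    insertMax i π (i.succAbove j) = (π j).castSucc := by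
  simp [insertMax]

theorem insertMax_bijective (n : ℕ) : Function.Bijective
    fun x : Fin (n + 1) × Equiv.Perm (Fin n) => insertMax x.1 x.2 := by
  rw [Fintype.bijective_iff_injective_and_card]
  constructor
  · rintro ⟨i, π⟩ ⟨i', π'⟩ h
    simp only at h
    obtain rfl : i = i' := by
      apply (insertMax i' π').injective
      rw [insertMax_self, ← h, insertMax_self]
    congr 1
    ext j
    have := congrArg (fun σ => ((σ (i.succAbove j) : Fin (n + 1)) : ℕ)) h
    simpa [insertMax_succAbove] using this
  · simp [Fintype.card_perm, Nat.factorial_succ]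

theorem permWord_insertMax {n : ℕ} (i : Fin (n + 1)) (π : Equiv.Perm (Fin n)) {j : ℕ}
    (hj : j ≤ n) : permWord (insertMax i π) j = insertLetter i n (permWord π) j := by
  rw [permWord, dif_pos (by omega), insertLetter]
  rcases lt_trichotomy j i with h | h | h
  · have e : (⟨j, by omega⟩ : Fin (n + 1)) = i.succAbove ⟨j, by omega⟩ := by
      rw [Fin.succAbove_of_castSucc_lt _ _ (by simpa [Fin.lt_def] using h)]; rfl
    rw [if_pos h, e, insertMax_succAbove, permWord, dif_pos]
    rfl
  · have e : (⟨j, by omega⟩ : Fin (n + 1)) = i := Fin.ext h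
    rw [if_neg (by omega), if_pos h, e, insertMax_self, Fin.val_last]
  · have e : (⟨j, by omega⟩ : Fin (n + 1)) = i.succAbove ⟨j - 1, by omega⟩ := by
      rw [Fin.succAbove_of_le_castSucc _ _ (by simp [Fin.le_def]; omega)]
      ext; simp; omega
    rw [if_neg (by omega), if_neg (by omega), e, insertMax_succAbove, permWord, dif_pos]
    rfl

theorem permWord_lt {n : ℕ} (π : Equiv.Perm (Fin (n + 1))) (j : ℕ) : permWord π j < n + 1 := by
  unfold permWord
  split_ifs <;> omega

theorem numAscents_le {n : ℕ} (π : Equiv.Perm (Fin (n + 1))) : numAscents π ≤ n := by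
  rw [numAscents_eq_wordAscents, wordAscents]
  refine (Finset.sum_le_card_nsmul _ _ 1 fun i _ => ?_).trans (by simp)
  split_ifs <;> simp

theorem sum_numAscents_succ {R : Type*} [Semiring R] (f : ℕ → R) (n : ℕ) :
    ∑ π : Equiv.Perm (Fin (n + 2)), f (numAscents π) =
      ∑ π : Equiv.Perm (Fin (n + 1)), ((numAscents π + 1 : ℕ) * f (numAscents π) +
        (n + 1 - numAscents π : ℕ) * f (numAscents π + 1)) := by
  rw [← (insertMax_bijective (n + 1)).sum_comp, Fintype.sum_prod_type_right]
  refine Finset.sum_congr rfl fun π _ => ?_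
  rw [numAscents_eq_wordAscents π, ← sum_wordAscents_insertLetter f fun j _ => permWord_lt π j,
    Finset.sum_range]
  refine Finset.sum_congr rfl fun i _ => ?_
  rw [numAscents_eq_wordAscents]
  exact congrArg f (wordAscents_congr fun j hj => permWord_insertMax i π hj)

end Insertion

/-! ### Frobenius' identity and the final estimate -/

theorem sum_X_pow_numAscents (n : ℕ) :
    ∑ π : Equiv.Perm (Fin (n + 1)), (X : ℤ[X]) ^ numAscents π =
      ∑ j ∈ Finset.range (n + 2), (surjectionNumber (n + 1) j : ℤ[X]) * (X - 1) ^ (n + 1 - j) := by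
  induction n with
  | zero =>
    have h (π : Equiv.Perm (Fin (0 + 1))) : numAscents π = 0 := Nat.le_zero.1 (numAscents_le π)
    simp [Finset.sum_range_succ, surjectionNumber, h]
  | succ n ih =>
    -- The Eulerian recurrence as a differential equation; applied to the right-hand side term by
    -- term, it reproduces the recurrence of the surjection numbers.
    have hA : ∑ π : Equiv.Perm (Fin (n + 2)), (X : ℤ[X]) ^ numAscents π =
        (1 + ((n + 1 : ℕ) : ℤ[X]) * X) * (∑ π : Equiv.Perm (Fin (n + 1)), (X : ℤ[X]) ^ numAscents π) +
        X * (1 - X) * derivative (∑ π : Equiv.Perm (Fin (n + 1)), (X : ℤ[X]) ^ numAscents π) := by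
      rw [sum_numAscents_succ (fun k => (X : ℤ[X]) ^ k), derivative_sum, Finset.mul_sum,
        Finset.mul_sum, ← Finset.sum_add_distrib]
      refine Finset.sum_congr rfl fun π _ => ?_
      obtain ⟨t, ht⟩ := Nat.exists_eq_add_of_le (numAscents_le π)
      rw [show n + 1 - numAscents π = t + 1 by omega, derivative_X_pow]
      have hn : ((n + 1 : ℕ) : ℤ[X]) = numAscents π + t + 1 := by exact_mod_cast congrArg (· + 1) ht
      rw [hn]
      rcases numAscents π with _ | k
      · simp
      · simp; ring
    rw [hA, ih, derivative_sum, Finset.mul_sum, Finset.mul_sum, ← Finset.sum_add_distrib]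
    have hterm : ∀ j ∈ Finset.range (n + 2),
        (1 + ((n + 1 : ℕ) : ℤ[X]) * X) * ((surjectionNumber (n + 1) j : ℤ[X]) * (X - 1) ^ (n + 1 - j)) +
          X * (1 - X) * derivative ((surjectionNumber (n + 1) j : ℤ[X]) * (X - 1) ^ (n + 1 - j)) =
        ((j : ℤ[X]) + 1) * (surjectionNumber (n + 1) j : ℤ[X]) * (X - 1) ^ (n + 1 - j) +
          (j : ℤ[X]) * (surjectionNumber (n + 1) j : ℤ[X]) * (X - 1) ^ (n + 2 - j) := by
      intro j hj
      rw [Finset.mem_range] at hj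
      obtain ⟨t, ht⟩ := Nat.exists_eq_add_of_le (Nat.lt_succ_iff.1 hj)
      rw [show n + 1 - j = t by omega, show n + 2 - j = t + 1 by omega, ht]
      rcases t with _ | t
      · simp; ring
      · simp [derivative_pow]; ring
    rw [Finset.sum_congr rfl hterm, Finset.sum_add_distrib, Finset.sum_range_succ' _ (n + 2)]
    simp only [surjectionNumber_succ_succ (n + 1)]
    -- Shifting j by one aligns the powers of X-1; the boundary terms j = 0 and j = n + 2 both
    -- vanish.
    have hlast := Finset.sum_range_succ'
      (fun j => (j : ℤ[X]) * (surjectionNumber (n + 1) j : ℤ[X]) * (X - 1) ^ (n + 2 - j)) (n + 2)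
    rw [Finset.sum_range_succ, surjectionNumber_eq_zero_of_lt (show n + 1 < n + 2 by omega)] at hlast
    simp only [Nat.cast_zero, mul_zero, zero_mul, add_zero] at hlast
    rw [hlast, ← Finset.sum_add_distrib]
    simp only [surjectionNumber, Nat.cast_zero, zero_mul, add_zero]
    refine Finset.sum_congr rfl fun j _ => ?_
    rw [show n + 2 - (j + 1) = n + 1 - j by omega]
    push_cast; ring

theorem residueSum_comp_sum_X_pow_numAscents (P r : ℤ) (l n : ℕ) (a : ℤ) :
    residueSum P r l ((∑ π : Equiv.Perm (Fin (n + 1)), (X : ℤ[X]) ^ numAscents π).comp (C a * X)) =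
      ∑ k ∈ (Finset.range (n + 1)).filter (fun k : ℕ => (k : ℤ) ≡ r [ZMOD P]),
        (eulerian (n + 1) k : ℤ) * a ^ k * Ring.choose (((k : ℤ) - r) / P) l := by
  have h1 (π : Equiv.Perm (Fin (n + 1))) :
      residueSum P r l (((X : ℤ[X]) ^ numAscents π).comp (C a * X)) =
        a ^ numAscents π * residueWeight P r l (numAscents π : ℕ) := by
    rw [← residueSum_monomial, ← C_mul_X_pow_eq_monomial]
    simp [mul_pow]
  rw [sum_comp, map_sum, Finset.sum_congr rfl fun π _ => h1 π,
    ← Finset.sum_fiberwise_of_maps_to (g := numAscents) (t := Finset.range (n + 1))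
      (fun π _ => Finset.mem_range.2 (Nat.lt_succ_of_le (numAscents_le π))), Finset.sum_filter]
  refine Finset.sum_congr rfl fun k _ => ?_
  rw [Finset.sum_congr rfl (g := fun _ => a ^ k * residueWeight P r l k)
    (fun π hπ => by rw [(Finset.mem_filter.1 hπ).2]), Finset.sum_const, residueWeight, eulerian]
  split_ifs <;> simp [mul_assoc]

/-- Here c is any natural upper bound for (q + lP)/φ, so both claims of the theorem are instances.
-/
theorem pow_dvd_sum_eulerian {p : ℕ} (hp : p.Prime) (s n : ℕ) (r : ℤ) (l c : ℕ) {a : ℤ}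
    (ha : a ≡ 1 [ZMOD p]) (hc : p ^ s + l * p ^ (s + 1) ≤ c * (p ^ s * (p - 1))) :
    (p : ℤ) ^ (padicValNat p ((n + 1) / p ^ s).factorial - c) ∣
      ∑ k ∈ (Finset.range (n + 1)).filter (fun k : ℕ => (k : ℤ) ≡ r [ZMOD (p : ℤ) ^ (s + 1)]),
        (eulerian (n + 1) k : ℤ) * a ^ k *
          Ring.choose (((k : ℤ) - r) / (p : ℤ) ^ (s + 1)) l := by
  have := Fact.mk hp
  have hφ : 0 < p ^ s * (p - 1) :=
    Nat.mul_pos (pow_pos hp.pos s) (by have := hp.two_le; omega)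
  rw [← residueSum_comp_sum_X_pow_numAscents, sum_X_pow_numAscents, sum_comp, map_sum]
  refine Finset.dvd_sum fun j _ => ?_
  have e : ((surjectionNumber (n + 1) j : ℤ[X]) * (X - 1) ^ (n + 1 - j)).comp (C a * X) =
      (surjectionNumber (n + 1) j : ℤ) • (C a * X - 1 : ℤ[X]) ^ (n + 1 - j) := by
    simp
  rw [e, map_smul, smul_eq_mul]
  have h1 := Int.natCast_dvd_natCast.2 (pow_dvd_surjectionNumber (p := p) s (n + 1) j)
  have h2 := pow_dvd_residueSum hp s (n + 1 - j) r l
    (C_mul_X_sub_one_pow_mem_fleckIdeal hp s (n + 1 - j) ha)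
  push_cast at h1 h2
  refine dvd_trans ?_ (mul_dvd_mul h1 h2)
  rw [← pow_add]
  refine pow_dvd_pow _ ?_
  have h3 : (n + 1 - j) / (p ^ s * (p - 1)) ≤
      (n + 1 - j - (p ^ s + l * p ^ (s + 1))) / (p ^ s * (p - 1)) + c := by
    rw [← Nat.add_mul_div_right _ _ hφ]
    exact Nat.div_le_div_right (by omega)
  generalize (n + 1 - j - (p ^ s + l * p ^ (s + 1))) / (p ^ s * (p - 1)) = y at h3 ⊢
  omega

theorem le_padicOrd_of_pow_dvd {p : ℕ} {N : ℤ} {x : ℤ} (h : (p : ℤ) ^ N.toNat ∣ x) :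
    (N : WithTop ℤ) ≤ padicOrd p x := by
  have h1 : (N.toNat : ℕ∞) ≤ emultiplicity (p : ℤ) x := le_emultiplicity_of_pow_dvd h
  unfold padicOrd
  cases hx : emultiplicity (p : ℤ) x with
  | top => exact le_top
  | coe m =>
    rw [hx, Nat.cast_le] at h1
    exact WithTop.coe_le_coe.2 (show N ≤ (m : ℤ) by omega)

theorem theorem1p1 (p : ℕ) (hp : p.Prime) (n : ℕ) (hn : 0 < n) (r : ℤ) (α : ℕ) (hα : 0 < α) :
    (∀ l : ℕ,
      (((padicValNat p (n / p ^ (α - 1)).factorial : ℤ)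
          - ⌈((p : ℚ) ^ (α - 1) + (l : ℚ) * (p : ℚ) ^ α) /
              ((p : ℚ) ^ (α - 1) * ((p : ℚ) - 1))⌉ : ℤ) : WithTop ℤ)
        ≤ padicOrd p
            (∑ k ∈ (Finset.range n).filter (fun k : ℕ => (k : ℤ) ≡ r [ZMOD (p : ℤ) ^ α]),
              (eulerian n k : ℤ) * Ring.choose (((k : ℤ) - r) / (p : ℤ) ^ α) l)) ∧
    (∀ a : ℤ, a ≡ 1 [ZMOD (p : ℤ)] → p ^ α ≤ n →
      (p : ℤ) ^ (padicValNat p (n / p ^ (α - 1)).factorial - 1) ∣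
        ∑ k ∈ (Finset.range n).filter (fun k : ℕ => (k : ℤ) ≡ r [ZMOD (p : ℤ) ^ α]),
          (eulerian n k : ℤ) * a ^ k) := by
  obtain ⟨n, rfl⟩ := Nat.exists_eq_add_of_le' hn
  obtain ⟨s, rfl⟩ := Nat.exists_eq_add_of_le' hα
  have hp1 : (1 : ℚ) < p := by exact_mod_cast hp.one_lt
  simp only [Nat.add_sub_cancel]
  refine ⟨fun l => ?_, fun a ha _ => ?_⟩
  · set x : ℚ := ((p : ℚ) ^ s + (l : ℚ) * (p : ℚ) ^ (s + 1)) / ((p : ℚ) ^ s * ((p : ℚ) - 1))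
      with hx
    have hden : 0 < (p : ℚ) ^ s * ((p : ℚ) - 1) := by
      have : 0 < (p : ℚ) - 1 := by linarith
      positivity
    have hx0 : 0 ≤ x := by positivity
    obtain ⟨c, hc⟩ := Int.eq_ofNat_of_zero_le (Int.ceil_nonneg hx0)
    have hxc : x ≤ c := by
      have := Int.le_ceil x
      rw [hc] at this
      exact_mod_cast this
    rw [hx, div_le_iff₀ hden] at hxc
    have h := pow_dvd_sum_eulerian hp s n r l c (Int.ModEq.refl (1 : ℤ)) (by
      have : ((p - 1 : ℕ) : ℚ) = p - 1 := by rw [Nat.cast_sub hp.one_lt.le, Nat.cast_one]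
      rw [← this] at hxc
      exact_mod_cast hxc)
    simp only [one_pow, mul_one] at h
    apply le_padicOrd_of_pow_dvd
    -- A negative bound truncates to exponent 0, which is harmless since orders are nonnegative.
    rw [hc, show ((padicValNat p ((n + 1) / p ^ s).factorial : ℤ) - (c : ℤ)).toNat =
      padicValNat p ((n + 1) / p ^ s).factorial - c by omega]
    exact h
  -- For l = 0 the value c = 1 suffices, because q ≤ q(p-1).
  · have h := pow_dvd_sum_eulerian hp s n r 0 1 ha (by
      have := Nat.le_mul_of_pos_right (p ^ s) (show 0 < p - 1 by have := hp.two_le; omega)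
      omega)
    simpa using h
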